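/- Let $m$ agents, a finite set of hypotheses $\Theta$ with a distinguished element $\theta^*$, and $N$ symbols $1,\dots,N$ be given. For every agent $i$ and $\theta\in\Theta$ let $p^i_\theta$ be a probability vector on the $N$ symbols and $R^i_\theta\ge 0$ an integer. *Data.* For each agent $i$ the symbols $S^i_1,S^i_2,\dots$ are independent and identically distributed with $\mathbb P(S^i_k=l)=[p^i_{\theta^*}]_l$, and for each $i,\theta$ the prior evidence $Z^i_\theta$ is a random vector with law $\mathrm{Multinomial}(p^i_\theta,R^i_\theta)$, all on one probability space (no independence between different agents, or between the $Z$'s and the $S$'s, is needed). Let $[n^i_k]_l$ be the number of $t\in\{1,\dots,k\}$ with $S^i_t=l$. *Network.* Let $\mathcal G_k=(\{1,\dots,m\},E_k)$, $k\ge 0$, be directed graphs, where $(j,i)\in E_k$ means that $j$ can send to $i$ at time $k$. Assume that $(\mathcal G_k)$ is $B$-strongly-connected: there is an integer $B\ge 1$ such that for every $k\ge 0$ the directed graph with edge set $\bigcup_{t=kB}^{(k+1)B-1}E_t$ is strongly connected. Let $d^j_k$ be the number of nodes $i\ne j$ with $(j,i)\in E_k$, and $N^i_k=\{i\}\cup\{j:(j,i)\in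 E_k\}$. *Algorithm.* Let $y^i_0=1$, $\mu^i_0(\theta)=1$ and, for $k\ge 0$, $$y^i_{k+1}=\sum_{j\in N^i_k}\frac{y^j_k}{d^j_k+1},\qquad \mu^i_{k+1}(\theta)=\Big(\prod_{j\in N^i_k}\mu^j_k(\theta)^{\frac{y^j_k}{d^j_k+1}}\cdot \ell^i_\theta(S^i_{k+1},n^i_{k+1})\Big)^{1/y^i_{k+1}},$$ where $$\ell^i_\theta(S^i_k,n^i_k)=\frac{\big([Z^i_\theta]_{S^i_k}+[n^i_k]_{S^i_k}\big)(N+k-1)}{(R^i_\theta+k+N-1)\,[n^i_k]_{S^i_k}}.$$ Then, almost surely, for every agent $i$ and every $\theta\in\Theta$, all beliefs $\mu^i_k(\theta)$ are positive and $$\lim_{k\to\infty}\log\mu^i_k(\theta)=\frac1m\sum_{j=1}^m\log\frac{\mathrm{Dirichlet}(p^j_{\theta^*};Z^j_\theta+\mathbf 1)}{\mathrm{Dirichlet}(p^j_{\theta^*};\mathbf 1)},$$ where $\mathrm{Dirichlet}(x;\alpha)=\frac1{\mathrm{Beta}(\alpha)}\prod_{l=1}^N x_l^{\alpha_l-1}$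 (with $0^0=1$) and $\mathrm{Beta}(\alpha)=\prod_{l=1}^N\Gamma(\alpha_l)\big/\Gamma\big(\sum_{l=1}^N\alpha_l\big)$. The limit is taken in $[-\infty,\infty)$ with $\log 0=-\infty$: it is $-\infty$ exactly when $[Z^j_\theta]_l>0$ and $[p^j_{\theta^*}]_l=0$ for some $j,l$. -/

import Mathlib

open MeasureTheory ProbabilityTheory Filter Topology

namespace SocialLearning

/-! ### Dirichlet density and multinomial law -/

/-- The multidimensional Beta function `∏ Γ(αₗ) / Γ(∑ αₗ)`. -/
noncomputable def multiBeta {N : ℕ} (α : Fin N → ℝ) : ℝ :=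
  (∏ l, Real.Gamma (α l)) / Real.Gamma (∑ l, α l)

/-- The Dirichlet density `Beta(α)⁻¹ ∏ xₗ ^ (αₗ - 1)`, with `0 ^ 0 = 1`. -/
noncomputable def dirichlet {N : ℕ} (x α : Fin N → ℝ) : ℝ :=
  (1 / multiBeta α) * ∏ l, x l ^ (α l - 1)

/-- The multinomial probability mass function with probability vector `p` and `n` trials. -/
noncomputable def multinomialPMF {N : ℕ} (p : Fin N → ℝ) (n : ℕ) (x : Fin N → ℕ) : ℝ :=
  if ∑ l, x l = n then (Nat.multinomial Finset.univ x : ℝ) * ∏ l, p l ^ x l else 0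

/-- The extended logarithm of a nonnegative real number, with `log 0 = -∞`. -/
noncomputable def extLog (x : ℝ) : EReal := ENNReal.log (ENNReal.ofReal x)

/-! ### Time-varying directed graphs; `(G k).Adj j i` means that `j` can send to `i` at time `k` -/

/-- There is a directed path between any two nodes, in both directions. -/
def StronglyConnected {V : Type*} (G : Digraph V) : Prop :=
  ∀ i j : V, Relation.ReflTransGen G.Adj i j

/-- The union of the graphs over each window `kB, …, (k+1)B - 1` is strongly connected. -/
def BStronglyConnected {V : Type*} (G : ℕ → Digraph V) (B : ℕ) : Prop :=
  1 ≤ B ∧ ∀ k : ℕ, StronglyConnected (⨆ t ∈ Set.Ico (k * B) ((k + 1) * B), G t)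

open Classical in
/-- The number `dʲₖ` of other nodes to which node `j` can send information at time `k`. -/
noncomputable def outDegree {m : ℕ} (G : ℕ → Digraph (Fin m)) (k : ℕ) (j : Fin m) : ℕ :=
  (Finset.univ.filter fun i => i ≠ j ∧ (G k).Adj j i).card

open Classical in
/-- The set `Nⁱₖ` of nodes whose information is available to node `i` at time `k`,
node `i` itself included. -/
noncomputable def inNeighbors {m : ℕ} (G : ℕ → Digraph (Fin m)) (k : ℕ) (i : Fin m) :
    Finset (Fin m) :=
  Finset.univ.filter fun j => j = i ∨ (G k).Adj j i

/-! ### The algorithm -/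

/-- The number `[nₖ]ₗ` of times that symbol `l` occurs among the symbols at times `1, …, k`. -/
def symbolCount {N : ℕ} (s : ℕ → Fin N) (k : ℕ) (l : Fin N) : ℕ :=
  ((Finset.Icc 1 k).filter fun t => s t = l).card

/-- The uncertain likelihood factor at time `k`, for prior counts `z` out of `R` trials,
observed counts `n` and current symbol `a`. -/
noncomputable def likelihoodFactor {N : ℕ} (z : Fin N → ℕ) (R k : ℕ) (n : Fin N → ℕ)
    (a : Fin N) : ℝ :=
  (((z a : ℝ) + n a) * ((N : ℝ) + k - 1)) / (((R : ℝ) + k + N - 1) * n a)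

/-- The push-sum weights `yⁱₖ`. -/
noncomputable def pushSum {m : ℕ} (G : ℕ → Digraph (Fin m)) : ℕ → Fin m → ℝ
  | 0, _ => 1
  | k + 1, i => ∑ j ∈ inNeighbors G k i, pushSum G k j / ((outDegree G k j : ℝ) + 1)

/-- The beliefs `μⁱₖ` on one fixed hypothesis, for which agent `i` holds the prior counts `z i`
out of `R i` trials, when agent `i` observes the symbol `s i k` at each time `k ≥ 1`. -/
noncomputable def belief {m N : ℕ} (G : ℕ → Digraph (Fin m)) (z : Fin m → Fin N → ℕ)
    (R : Fin m → ℕ) (s : Fin m → ℕ → Fin N) : ℕ → Fin m → ℝ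
  | 0, _ => 1
  | k + 1, i =>
      ((∏ j ∈ inNeighbors G k i,
            belief G z R s k j ^ (pushSum G k j / ((outDegree G k j : ℝ) + 1))) *
          likelihoodFactor (z i) (R i) (k + 1) (symbolCount (s i) (k + 1)) (s i (k + 1))) ^
        (1 / pushSum G (k + 1) i)

end SocialLearning

namespace SocialLearning

/-! ### Connectivity -/

/-! Taking logarithms turns the belief update into push-sum: `log μ` is averaged with weights `y j /
(d j + 1)`, and `log ℓ` enters as a perturbation. Along almost every path each symbol that occurs
has positive probability, so its count tends to infinity and `ℓ → 1` (`tendsto_likelihoodFactor`).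
With vanishing perturbations, push-sum follows the network average of the accumulated perturbations
with error tending to `0` (`tendsto_sub_average`); no summability is needed. It remains to find the
limit of the accumulated factors of one agent. Their product telescopes to a ratio of rising
factorials (`prod_likelihoodFactor`), and the strong law of large numbers gives its limit, which is
the Dirichlet ratio (`dirichlet_div_dirichlet_one`). A limit `-∞` needs no separate case: the
beliefs converge in the reals, possibly to `0`, and the continuous `extLog` is applied last. -/

theorem StronglyConnected.exists_adj_leaving {V : Type*} {G : Digraph V}
    (hG : StronglyConnected G) {T : Set V} {a b : V} (ha : a ∈ T) (hb : b ∉ T) :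
    ∃ j ∈ T, ∃ i, i ∉ T ∧ G.Adj j i := by
  by_contra! h
  have key : ∀ c, Relation.ReflTransGen G.Adj a c → c ∈ T := by
    intro c hc
    induction hc with
    | refl => exact ha
    | tail _ hcd ih => exact by_contra fun hd => h _ ih _ hd hcd
  exact hb (key b (hG a b))

theorem mem_inNeighbors {m : ℕ} {G : ℕ → Digraph (Fin m)} {k : ℕ} {i j : Fin m} :
    j ∈ inNeighbors G k i ↔ j = i ∨ (G k).Adj j i := by
  simp [inNeighbors]

theorem self_mem_inNeighbors {m : ℕ} (G : ℕ → Digraph (Fin m)) (k : ℕ) (i : Fin m) :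
    i ∈ inNeighbors G k i := mem_inNeighbors.2 (Or.inl rfl)

open Classical in
/-- A nonnegative process that retains a fraction `α` along every edge and every self-loop is,
after `m + 1` windows, everywhere at least a fixed fraction of its value at any single node. -/
theorem BStronglyConnected.pow_mul_le {m : ℕ} {G : ℕ → Digraph (Fin m)} {B : ℕ}
    (hG : BStronglyConnected G B) {α : ℝ} (hα : 0 ≤ α) (s : ℕ) (w : ℕ → Fin m → ℝ)
    (hw : ∀ t, s ≤ t → ∀ i, ∀ j ∈ inNeighbors G t i, α * w t j ≤ w (t + 1) i) (i j : Fin m) :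
    α ^ ((m + 1) * B) * w s j ≤ w (s + (m + 1) * B) i := by
  -- The nodes already reached by the value at `j`, at a loss of one factor `α` per step. Self-loops
  -- keep a reached node reached, and an edge leaving the set within a window makes it strictly
  -- larger.
  set T : ℕ → Finset (Fin m) := fun t =>
    Finset.univ.filter fun i => α ^ (t - s) * w s j ≤ w t i with hT
  have memT : ∀ t i, i ∈ T t ↔ α ^ (t - s) * w s j ≤ w t i := by simp [hT]
  have step : ∀ t, s ≤ t → ∀ i, ∀ l ∈ inNeighbors G t i, l ∈ T t → i ∈ T (t + 1) := by
    intro t ht i l hl hlT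
    rw [memT] at hlT ⊢
    calc α ^ (t + 1 - s) * w s j = α * (α ^ (t - s) * w s j) := by
          rw [Nat.succ_sub ht, pow_succ]; ring
      _ ≤ α * w t l := by gcongr
      _ ≤ _ := hw t ht i l hl
  have mono : ∀ t t', s ≤ t → t ≤ t' → T t ⊆ T t' := by
    intro t t' hs htt'
    induction t', htt' using Nat.le_induction with
    | base => exact Finset.Subset.refl _
    | succ n hn ih =>
      exact ih.trans fun l hl => step n (hs.trans hn) l l (self_mem_inNeighbors G n l) hl
  have grow : ∀ k, s ≤ k * B → j ∈ T (k * B) → T (k * B) ≠ Finset.univ →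
      T (k * B) ⊂ T ((k + 1) * B) := by
    intro k hk hj hne
    obtain ⟨b, hb⟩ : ∃ b, b ∉ T (k * B) := by
      by_contra! h
      exact hne (Finset.eq_univ_iff_forall.2 h)
    obtain ⟨a, ha, c, hc, hac⟩ := (hG.2 k).exists_adj_leaving (T := (T (k * B) : Set (Fin m)))
      (Finset.mem_coe.2 hj) (fun h => hb (Finset.mem_coe.1 h))
    have hkB : k * B ≤ (k + 1) * B := Nat.mul_le_mul_right _ (Nat.le_succ k)
    refine (Finset.ssubset_iff_of_subset (mono _ _ hk hkB)).2 ⟨c, ?_, fun h => hc h⟩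
    simp only [Digraph.iSup_adj] at hac
    obtain ⟨t, ht, htac⟩ := hac
    have hst : s ≤ t := hk.trans ht.1
    have hat : a ∈ T t := mono _ _ hk ht.1 ha
    exact mono (t + 1) _ (by omega) ht.2
      (step t hst c a (mem_inNeighbors.2 (Or.inr htac)) hat)
  have hB := hG.1
  -- A window boundary at most `B` steps after `s`. The `m` full windows that follow bring the total
  -- to `(m + 1) * B`.
  obtain ⟨k₀, hk₀, hk₀'⟩ : ∃ k₀, s ≤ k₀ * B ∧ k₀ * B ≤ s + B := by
    refine ⟨s / B + 1, ?_, ?_⟩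
    · have := Nat.lt_div_mul_add (a := s) hB
      rw [Nat.add_mul]; omega
    · have := Nat.div_mul_le_self s B
      rw [Nat.add_mul]; omega
  have hjs : j ∈ T s := by simp [memT]
  have card : ∀ n, T ((k₀ + n) * B) = Finset.univ ∨ n + 1 ≤ (T ((k₀ + n) * B)).card := by
    intro n
    have hsn : ∀ n, s ≤ (k₀ + n) * B := fun n =>
      hk₀.trans (Nat.mul_le_mul_right _ (Nat.le_add_right _ _))
    induction n with
    | zero =>
      right
      exact Finset.card_pos.2 ⟨j, mono s _ le_rfl (hsn 0) hjs⟩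
    | succ n ih =>
      by_cases h : T ((k₀ + n) * B) = Finset.univ
      · left
        refine Finset.univ_subset_iff.1 (h ▸ mono _ _ (hsn n) ?_)
        exact Nat.mul_le_mul_right _ (by omega)
      · right
        have h1 := ih.resolve_left h
        have h2 := Finset.card_lt_card
          (grow (k₀ + n) (hsn n) (mono s _ le_rfl (hsn n) hjs) h)
        rw [← add_assoc]
        omega
  have hfull : T ((k₀ + m) * B) = Finset.univ := by
    refine (card m).resolve_right fun h => ?_
    have := Finset.card_le_univ (T ((k₀ + m) * B))
    rw [Fintype.card_fin] at this
    omega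
  have hi : i ∈ T (s + (m + 1) * B) := by
    refine mono ((k₀ + m) * B) _ ?_ ?_ (hfull ▸ Finset.mem_univ i)
    · exact hk₀.trans (Nat.mul_le_mul_right _ (Nat.le_add_right _ _))
    · rw [Nat.add_mul, Nat.add_mul]; omega
  rw [memT] at hi
  simpa using hi

/-! ### Consensus for perturbed averaging -/

/-- Once `b < (1 - q) * (ε / 2)`, the level `ε / 2` is preserved by the recursion and the excess
over it shrinks by `q` every `L` steps. Each residue class mod `L` is followed separately; `C`
bounds all the starting values. -/
theorem tendsto_zero_of_le_mul_add {D b : ℕ → ℝ} {q : ℝ} {L : ℕ} (hL : 0 < L) (hq0 : 0 ≤ q)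
    (hq1 : q < 1) (hD : ∀ s, 0 ≤ D s) (hb : Tendsto b atTop (𝓝 0))
    (h : ∀ s, D (s + L) ≤ q * D s + b s) : Tendsto D atTop (𝓝 0) := by
  rw [Metric.tendsto_atTop]
  intro ε hε
  obtain ⟨s₀, hs₀⟩ := (hb.eventually (gt_mem_nhds
    (mul_pos (sub_pos.2 hq1) (half_pos hε)))).exists_forall_of_atTop
  set C : ℝ := ∑ r ∈ Finset.range L, D (s₀ + r) with hC
  have key : ∀ n r, r < L → D (s₀ + r + n * L) ≤ ε / 2 + q ^ n * C := by
    intro n r hr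
    induction n with
    | zero =>
      have : D (s₀ + r) ≤ C :=
        Finset.single_le_sum (f := fun r => D (s₀ + r)) (fun _ _ => hD _) (Finset.mem_range.2 hr)
      simp only [zero_mul, add_zero, pow_zero, one_mul]
      linarith
    | succ n ih =>
      have h1 := h (s₀ + r + n * L)
      have h2 := hs₀ (s₀ + r + n * L) (by omega)
      have h3 := mul_le_mul_of_nonneg_left ih hq0
      rw [Nat.succ_mul, ← add_assoc, pow_succ]
      nlinarith
  have hlim : Tendsto (fun n : ℕ => q ^ n * C) atTop (𝓝 0) := by
    simpa using (tendsto_pow_atTop_nhds_zero_of_lt_one hq0 hq1).mul_const C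
  obtain ⟨n₀, hn₀⟩ := (hlim.eventually (gt_mem_nhds (half_pos hε))).exists_forall_of_atTop
  refine ⟨s₀ + n₀ * L, fun t ht => ?_⟩
  rw [Real.dist_eq, sub_zero, abs_of_nonneg (hD t)]
  have hmod := Nat.mod_add_div (t - s₀) L
  have hn : n₀ ≤ (t - s₀) / L := (Nat.le_div_iff_mul_le hL).2 (by omega)
  have h1 := key ((t - s₀) / L) ((t - s₀) % L) (Nat.mod_lt _ hL)
  have h2 := hn₀ _ hn
  have ht' : s₀ + (t - s₀) % L + (t - s₀) / L * L = t := by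
    rw [mul_comm] at hmod
    have : s₀ ≤ t := by omega
    omega
  rw [ht'] at h1
  linarith

/-- Averaging with uniformly positive weights over a `B`-strongly-connected network, up to the
error `ε k` at step `k`. -/
structure IsPerturbedAveraging {m : ℕ} (G : ℕ → Digraph (Fin m)) (γ : ℝ)
    (W : ℕ → Fin m → Fin m → ℝ) (ε : ℕ → ℝ) (r : ℕ → Fin m → ℝ) : Prop where
  sum_eq_one : ∀ k i, ∑ j ∈ inNeighbors G k i, W k i j = 1
  le_weight : ∀ k i, ∀ j ∈ inNeighbors G k i, γ ≤ W k i j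
  abs_sub_le : ∀ k i, |r (k + 1) i - ∑ j ∈ inNeighbors G k i, W k i j * r k j| ≤ ε k

namespace IsPerturbedAveraging

variable {m : ℕ} {G : ℕ → Digraph (Fin m)} {γ : ℝ} {W : ℕ → Fin m → Fin m → ℝ} {ε : ℕ → ℝ}
  {r : ℕ → Fin m → ℝ}

theorem neg (h : IsPerturbedAveraging G γ W ε r) :
    IsPerturbedAveraging G γ W ε fun k i => -r k i where
  sum_eq_one := h.sum_eq_one
  le_weight := h.le_weight
  abs_sub_le k i := by
    have := h.abs_sub_le k i
    rw [abs_sub_comm] at this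
    simpa [sub_eq_add_neg, add_comm] using this

/-- The gap `w` between `r` and `M` plus the accumulated errors is nonnegative and at least the
average of its previous values, so `pow_mul_le` spreads the gap at `j` to every node. -/
theorem le_sub {B : ℕ} (hG : BStronglyConnected G B) (hγ : 0 ≤ γ)
    (h : IsPerturbedAveraging G γ W ε r) {s : ℕ} {M : ℝ} (hM : ∀ i, r s i ≤ M) (i j : Fin m) :
    r (s + (m + 1) * B) i ≤
      M + ∑ τ ∈ Finset.range ((m + 1) * B), ε (s + τ) - γ ^ ((m + 1) * B) * (M - r s j) := by
  set w : ℕ → Fin m → ℝ :=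
    fun t i => M + ∑ τ ∈ Finset.range (t - s), ε (s + τ) - r t i with hw
  have avg : ∀ t, s ≤ t → ∀ i, ∑ j ∈ inNeighbors G t i, W t i j * w t j ≤ w (t + 1) i := by
    intro t ht i
    have h1 := (abs_le.1 (h.abs_sub_le t i)).2
    have h2 : ∑ j ∈ inNeighbors G t i, W t i j * w t j =
        (M + ∑ τ ∈ Finset.range (t - s), ε (s + τ)) -
          ∑ j ∈ inNeighbors G t i, W t i j * r t j := by
      simp only [hw, mul_sub, Finset.sum_sub_distrib, ← Finset.sum_mul, h.sum_eq_one, one_mul]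
    rw [h2]
    simp only [hw]
    rw [Nat.succ_sub ht, Finset.sum_range_succ, Nat.add_sub_cancel' ht]
    linarith
  have nonneg : ∀ t, s ≤ t → ∀ i, 0 ≤ w t i := by
    intro t ht
    induction t, ht using Nat.le_induction with
    | base => intro i; simpa [hw] using hM i
    | succ t ht ih =>
      intro i
      exact (Finset.sum_nonneg fun j hj =>
        mul_nonneg (hγ.trans (h.le_weight t i j hj)) (ih j)).trans (avg t ht i)
  have step : ∀ t, s ≤ t → ∀ i, ∀ j ∈ inNeighbors G t i, γ * w t j ≤ w (t + 1) i := by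
    intro t ht i j hj
    calc γ * w t j ≤ W t i j * w t j :=
          mul_le_mul_of_nonneg_right (h.le_weight t i j hj) (nonneg t ht j)
      _ ≤ ∑ j ∈ inNeighbors G t i, W t i j * w t j :=
          Finset.single_le_sum (f := fun j => W t i j * w t j)
            (fun j hj => mul_nonneg (hγ.trans (h.le_weight t i j hj)) (nonneg t ht j)) hj
      _ ≤ _ := avg t ht i
  have := hG.pow_mul_le hγ s w step i j
  simp only [hw, Nat.sub_self, Finset.range_zero, Finset.sum_empty, add_zero,
    Nat.add_sub_cancel_left] at this
  linarith

/-- The spread `D`, maximum minus minimum, contracts by `1 - γ ^ L` over `L` steps, up to an error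
that tends to `0`. -/
theorem tendsto_sub {B : ℕ} (hG : BStronglyConnected G B) (hγ : 0 < γ)
    (h : IsPerturbedAveraging G γ W ε r) (hε : Tendsto ε atTop (𝓝 0)) (i j : Fin m) :
    Tendsto (fun k => r k i - r k j) atTop (𝓝 0) := by
  have : Nonempty (Fin m) := ⟨i⟩
  set L := (m + 1) * B with hL
  have hLpos : 0 < L := Nat.mul_pos (Nat.succ_pos m) hG.1
  have hγ1 : γ ≤ 1 := by
    have hk : ∀ l ∈ inNeighbors G 0 i, 0 ≤ W 0 i l := fun l hl =>
      hγ.le.trans (h.le_weight 0 i l hl)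
    calc γ ≤ W 0 i i := h.le_weight 0 i i (self_mem_inNeighbors G 0 i)
      _ ≤ ∑ l ∈ inNeighbors G 0 i, W 0 i l :=
        Finset.single_le_sum hk (self_mem_inNeighbors G 0 i)
      _ = 1 := h.sum_eq_one 0 i
  set D : ℕ → ℝ := fun k => ⨆ q : Fin m × Fin m, (r k q.1 - r k q.2) with hD
  have le_D : ∀ k a b, r k a - r k b ≤ D k := fun k a b =>
    le_ciSup (f := fun q : Fin m × Fin m => r k q.1 - r k q.2) (Set.finite_range _).bddAbove (a, b)
  have D_nonneg : ∀ k, 0 ≤ D k := fun k => by simpa using le_D k i i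
  have hD0 : Tendsto D atTop (𝓝 0) := by
    refine tendsto_zero_of_le_mul_add (q := 1 - γ ^ L)
      (b := fun s => 2 * ∑ τ ∈ Finset.range L, ε (s + τ)) hLpos
      (sub_nonneg.2 (pow_le_one₀ hγ.le hγ1)) (sub_lt_self _ (pow_pos hγ L)) D_nonneg ?_ ?_
    · have : Tendsto (fun s => ∑ τ ∈ Finset.range L, ε (s + τ)) atTop
          (𝓝 (∑ τ ∈ Finset.range L, (0 : ℝ))) :=
        tendsto_finsetSum _ fun τ _ => hε.comp (tendsto_add_atTop_nat τ)
      simpa using this.const_mul 2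
    · intro s
      refine ciSup_le fun q => ?_
      obtain ⟨a, ha⟩ := Finite.exists_max (r s)
      obtain ⟨b, hb⟩ := Finite.exists_min (r s)
      have h1 := h.le_sub hG hγ.le (M := r s a) ha q.1 b
      -- The gap of `-r` at the minimiser `b` is zero, so this only says that the minimum drops by
      -- at most the errors; the contraction comes from `h1` alone.
      have h2 := h.neg.le_sub hG hγ.le (s := s) (M := -r s b) (fun l => neg_le_neg (hb l)) q.2 b
      have h3 := mul_le_mul_of_nonneg_left (le_D s a b) (pow_pos hγ L).le
      have h4 : D s = r s a - r s b :=
        le_antisymm (ciSup_le fun q => sub_le_sub (ha _) (hb _)) (le_D s a b)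
      rw [sub_self, mul_zero, ← hL] at h2
      rw [← hL] at h1
      rw [h4]
      linarith
  refine squeeze_zero_norm (fun k => ?_) hD0
  rw [Real.norm_eq_abs, abs_le]
  constructor
  · linarith [le_D k j i]
  · exact le_D k i j

end IsPerturbedAveraging

/-! ### Push-sum -/

section PushSum

variable {m : ℕ} (G : ℕ → Digraph (Fin m))

theorem outDegree_add_one_le (k : ℕ) (j : Fin m) : (outDegree G k j : ℝ) + 1 ≤ m := by
  classical
  have : outDegree G k j < m := by
    have h : outDegree G k j < (Finset.univ : Finset (Fin m)).card := by
      unfold outDegree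
      exact Finset.card_lt_card (Finset.filter_ssubset.2 ⟨j, Finset.mem_univ j, by simp⟩)
    simpa using h
  exact_mod_cast this

/-- Each node splits its value evenly among its out-neighbours, so the total is preserved. -/
theorem sum_sum_inNeighbors (k : ℕ) (f : Fin m → ℝ) :
    ∑ i, ∑ j ∈ inNeighbors G k i, f j / ((outDegree G k j : ℝ) + 1) = ∑ j, f j := by
  classical
  have hcard : ∀ j, (Finset.univ.filter fun i => j ∈ inNeighbors G k i).card
      = outDegree G k j + 1 := by
    intro j
    have : (Finset.univ.filter fun i => j ∈ inNeighbors G k i) =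
        insert j (Finset.univ.filter fun i => i ≠ j ∧ (G k).Adj j i) := by
      ext i
      simp only [Finset.mem_filter, Finset.mem_univ, true_and, mem_inNeighbors,
        Finset.mem_insert]
      by_cases hij : i = j
      · simp [hij]
      · simp [hij, Ne.symm hij]
    rw [this, Finset.card_insert_of_notMem (by simp), outDegree]
  calc ∑ i, ∑ j ∈ inNeighbors G k i, f j / ((outDegree G k j : ℝ) + 1)
      = ∑ j, ∑ i ∈ Finset.univ.filter (fun i => j ∈ inNeighbors G k i),
          f j / ((outDegree G k j : ℝ) + 1) :=
        Finset.sum_comm' (by simp)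
    _ = ∑ j, f j := by
        refine Finset.sum_congr rfl fun j _ => ?_
        rw [Finset.sum_const, hcard, nsmul_eq_mul]
        push_cast
        field_simp

theorem pushSum_succ (k : ℕ) (i : Fin m) : pushSum G (k + 1) i =
    ∑ j ∈ inNeighbors G k i, pushSum G k j / ((outDegree G k j : ℝ) + 1) := rfl

theorem pushSum_pos (k : ℕ) (i : Fin m) : 0 < pushSum G k i := by
  induction k generalizing i with
  | zero => exact one_pos
  | succ k ih =>
    rw [pushSum_succ]
    exact Finset.sum_pos (fun j _ => div_pos (ih j) (by positivity))
      ⟨i, self_mem_inNeighbors G k i⟩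

theorem sum_pushSum (k : ℕ) : ∑ i, pushSum G k i = m := by
  induction k with
  | zero => simp [pushSum]
  | succ k ih => simp only [pushSum_succ, sum_sum_inNeighbors, ih]

theorem pushSum_le (k : ℕ) (i : Fin m) : pushSum G k i ≤ m :=
  (Finset.single_le_sum (fun j _ => (pushSum_pos G k j).le) (Finset.mem_univ i)).trans_eq
    (sum_pushSum G k)

theorem inv_mul_pushSum_le (k : ℕ) (i j : Fin m) (hj : j ∈ inNeighbors G k i) :
    (m : ℝ)⁻¹ * pushSum G k j ≤ pushSum G (k + 1) i := by
  rw [pushSum_succ]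
  calc (m : ℝ)⁻¹ * pushSum G k j = pushSum G k j / m := by rw [div_eq_inv_mul]
    _ ≤ pushSum G k j / ((outDegree G k j : ℝ) + 1) :=
        div_le_div_of_nonneg_left (pushSum_pos G k j).le (by positivity)
          (outDegree_add_one_le G k j)
    _ ≤ _ := Finset.single_le_sum
        (f := fun j => pushSum G k j / ((outDegree G k j : ℝ) + 1))
        (fun j _ => div_nonneg (pushSum_pos G k j).le (by positivity)) hj

/-- The total mass is `m`, so at every time some node has weight at least `1`; after `L` steps every
node holds at least `m⁻¹ ^ L` of it. Before time `L` the self-loops suffice. -/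
theorem exists_forall_le_pushSum {G : ℕ → Digraph (Fin m)} {B : ℕ}
    (hG : BStronglyConnected G B) : ∃ δ > 0, ∀ k i, δ ≤ pushSum G k i := by
  rcases Nat.eq_zero_or_pos m with rfl | hm
  · exact ⟨1, one_pos, fun _ i => i.elim0⟩
  have hm' : (0 : ℝ) < m := by exact_mod_cast hm
  have hα : (0 : ℝ) < (m : ℝ)⁻¹ := inv_pos.2 hm'
  have hα1 : (m : ℝ)⁻¹ ≤ 1 := inv_le_one_of_one_le₀ (by exact_mod_cast hm)
  set L := (m + 1) * B
  refine ⟨(m : ℝ)⁻¹ ^ L, pow_pos hα L, fun k i => ?_⟩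
  rcases le_total L k with hk | hk
  · obtain ⟨s, rfl⟩ := Nat.exists_eq_add_of_le' hk
    obtain ⟨j, -, hj⟩ : ∃ j ∈ Finset.univ, 1 ≤ pushSum G s j := by
      refine Finset.exists_le_of_sum_le (f := fun _ => (1 : ℝ)) ⟨i, Finset.mem_univ i⟩ ?_
      rw [sum_pushSum]
      simp
    calc (m : ℝ)⁻¹ ^ L ≤ (m : ℝ)⁻¹ ^ L * pushSum G s j :=
          le_mul_of_one_le_right (pow_pos hα L).le hj
      _ ≤ _ := hG.pow_mul_le hα.le s (pushSum G)
          (fun t _ i j hj => inv_mul_pushSum_le G t i j hj) i j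
  · have : ∀ k, (m : ℝ)⁻¹ ^ k ≤ pushSum G k i := by
      intro k
      induction k with
      | zero => simp [pushSum]
      | succ k ih =>
        rw [pow_succ']
        exact (mul_le_mul_of_nonneg_left ih hα.le).trans
          (inv_mul_pushSum_le G k i i (self_mem_inNeighbors G k i))
    exact (pow_le_pow_of_le_one hα.le hα1 hk).trans (this k)

/-- Push-sum with vanishing perturbations tracks the network average of the accumulated
perturbations. -/
theorem tendsto_sub_average {G : ℕ → Digraph (Fin m)} {B : ℕ}
    (hG : BStronglyConnected G B) {r u : ℕ → Fin m → ℝ} (hr0 : ∀ i, r 0 i = 0)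
    (hr : ∀ k i, pushSum G (k + 1) i * r (k + 1) i =
      ∑ j ∈ inNeighbors G k i, pushSum G k j / ((outDegree G k j : ℝ) + 1) * r k j + u k i)
    (hu : ∀ i, Tendsto (fun k => u k i) atTop (𝓝 0)) (i : Fin m) :
    Tendsto (fun k => r k i - 1 / (m : ℝ) * ∑ j, ∑ t ∈ Finset.range k, u t j) atTop (𝓝 0) := by
  have hm : (0 : ℝ) < m := by exact_mod_cast Fin.pos i
  obtain ⟨δ, hδ, hδy⟩ := exists_forall_le_pushSum hG
  -- Dividing by `pushSum G (k + 1) i` makes the weights sum to `1` at each receiver. In `δ / m /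
  -- m`, `δ` bounds the sender's weight below, and the two `m` bound the out-degree plus one and the
  -- receiver's weight above.
  have havg : IsPerturbedAveraging G (δ / m / m)
      (fun k i j => pushSum G k j / ((outDegree G k j : ℝ) + 1) / pushSum G (k + 1) i)
      (fun k => (∑ i, |u k i|) / δ) r := by
    refine ⟨fun k i => ?_, fun k i j hj => ?_, fun k i => ?_⟩
    · rw [← Finset.sum_div, ← pushSum_succ, div_self (pushSum_pos G (k + 1) i).ne']
    · have h1 := hδy k j
      have h2 := outDegree_add_one_le G k j
      have h3 := pushSum_le G (k + 1) i
      have h4 := pushSum_pos G (k + 1) i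
      have h5 := pushSum_pos G k j
      gcongr
    · have hy := pushSum_pos G (k + 1) i
      have : r (k + 1) i - ∑ j ∈ inNeighbors G k i,
          pushSum G k j / ((outDegree G k j : ℝ) + 1) / pushSum G (k + 1) i * r k j
          = u k i / pushSum G (k + 1) i := by
        rw [eq_div_iff hy.ne', sub_mul, mul_comm, hr, Finset.sum_mul, add_comm, add_sub_assoc,
          ← Finset.sum_sub_distrib, Finset.sum_eq_zero, add_zero]
        intro j _
        field_simp
        ring
      rw [this, abs_div, abs_of_pos hy]
      exact div_le_div₀ (Finset.sum_nonneg fun _ _ => abs_nonneg _)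
        (Finset.single_le_sum (f := fun i => |u k i|) (fun _ _ => abs_nonneg _)
          (Finset.mem_univ i)) hδ (hδy (k + 1) i)
  have hε : Tendsto (fun k => (∑ i, |u k i|) / δ) atTop (𝓝 0) := by
    have : Tendsto (fun k => ∑ i, |u k i|) atTop (𝓝 (∑ _i : Fin m, (0 : ℝ))) :=
      tendsto_finsetSum _ fun i _ => by simpa using (hu i).abs
    simpa using this.div_const δ
  have hsum : ∀ k, ∑ j, pushSum G k j * r k j = ∑ j, ∑ t ∈ Finset.range k, u t j := by
    intro k
    induction k with
    | zero => simp [hr0]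
    | succ k ih =>
      simp only [hr, Finset.sum_range_succ, Finset.sum_add_distrib, ← ih]
      rw [← sum_sum_inNeighbors G k fun j => pushSum G k j * r k j]
      simp only [div_mul_eq_mul_div]
  -- Since the `y` weights sum to `m`, conservation (`hsum`) writes the deviation as a weighted mean
  -- of disagreements `r k i - r k j`.
  have heq : ∀ k, r k i - 1 / (m : ℝ) * ∑ j, ∑ t ∈ Finset.range k, u t j =
      1 / (m : ℝ) * ∑ j, pushSum G k j * (r k i - r k j) := by
    intro k
    simp only [mul_sub, Finset.sum_sub_distrib, ← Finset.sum_mul, sum_pushSum, hsum]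
    field_simp
  simp only [heq]
  have : Tendsto (fun k => ∑ j, pushSum G k j * (r k i - r k j)) atTop
      (𝓝 (∑ _j : Fin m, (0 : ℝ))) := by
    refine tendsto_finsetSum _ fun j _ => ?_
    refine bdd_le_mul_tendsto_zero (b := 0) (B := (m : ℝ))
      (Eventually.of_forall fun k => (pushSum_pos G k j).le)
      (Eventually.of_forall fun k => pushSum_le G k j)
      (havg.tendsto_sub hG (by positivity) hε i j)
  simpa using this.const_mul (1 / (m : ℝ))

end PushSum

/-! ### Symbol frequencies and accumulated likelihood factors -/

section Likelihood

variable {N : ℕ}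

theorem symbolCount_succ (s : ℕ → Fin N) (k : ℕ) (l : Fin N) :
    symbolCount s (k + 1) l = symbolCount s k l + if s (k + 1) = l then 1 else 0 := by
  unfold symbolCount
  rw [← Finset.insert_Icc_right_eq_Icc_add_one (by omega), Finset.filter_insert]
  split_ifs with h
  · rw [Finset.card_insert_of_notMem (by simp)]
  · rfl

theorem symbolCount_self_pos (s : ℕ → Fin N) (k : ℕ) :
    0 < symbolCount s (k + 1) (s (k + 1)) := by
  simp [symbolCount_succ]

theorem likelihoodFactor_pos (z : Fin N → ℕ) (R : ℕ) (s : ℕ → Fin N) (k : ℕ) :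
    0 < likelihoodFactor z R (k + 1) (symbolCount s (k + 1)) (s (k + 1)) := by
  have hn : (0 : ℝ) < symbolCount s (k + 1) (s (k + 1)) := by
    exact_mod_cast symbolCount_self_pos s k
  have hN : (0 : ℝ) < N := by exact_mod_cast Fin.pos (s 0)
  unfold likelihoodFactor
  have h1 : (0 : ℝ) < (N : ℝ) + (k + 1 : ℕ) - 1 := by push_cast; linarith [k.cast_nonneg (α := ℝ)]
  have h2 : (0 : ℝ) < (R : ℝ) + (k + 1 : ℕ) + N - 1 := by
    push_cast; linarith [k.cast_nonneg (α := ℝ), R.cast_nonneg (α := ℝ)]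
  positivity

/-- Observing a symbol `l` with previous count `n` multiplies its rising factorial by `(n + 1 + z l)
/ (n + 1)`; replacing `N + k` by `N + k + 1` in the denominator supplies the rest of the factor. -/
theorem prod_likelihoodFactor (z : Fin N → ℕ) (R : ℕ) (s : ℕ → Fin N) (k : ℕ) :
    ∏ t ∈ Finset.range k, likelihoodFactor z R (t + 1) (symbolCount s (t + 1)) (s (t + 1)) =
      (∏ l, ((symbolCount s k l + 1).ascFactorial (z l) : ℝ) / (z l).factorial) *
        ((N.ascFactorial R : ℝ) / ((N + k).ascFactorial R : ℝ)) := by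
  have hN : 0 < N := Fin.pos (s 0)
  have hasc : ∀ a b : ℕ, 0 < a → (a.ascFactorial b : ℝ) ≠ 0 := fun a b ha => by
    obtain ⟨a, rfl⟩ := Nat.exists_eq_add_of_le' ha
    exact_mod_cast (Nat.ascFactorial_pos a b).ne'
  induction k with
  | zero =>
    simp [symbolCount, Nat.one_ascFactorial, div_self (hasc N R hN), Nat.factorial_ne_zero]
  | succ k ih =>
    have hprod : ∏ l, ((symbolCount s (k + 1) l + 1).ascFactorial (z l) : ℝ) / (z l).factorial =
        (∏ l, ((symbolCount s k l + 1).ascFactorial (z l) : ℝ) / (z l).factorial) *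
          (((symbolCount s k (s (k + 1)) : ℝ) + 1 + z (s (k + 1))) /
            (symbolCount s k (s (k + 1)) + 1)) := by
      have : ∀ l, ((symbolCount s (k + 1) l + 1).ascFactorial (z l) : ℝ) / (z l).factorial =
          ((symbolCount s k l + 1).ascFactorial (z l) : ℝ) / (z l).factorial *
            if s (k + 1) = l then ((symbolCount s k l : ℝ) + 1 + z l) / (symbolCount s k l + 1)
              else 1 := by
        intro l
        rw [symbolCount_succ]
        split_ifs with h
        · have h1 : ((symbolCount s k l : ℝ) + 1) *
              ((symbolCount s k l + 1 + 1).ascFactorial (z l) : ℝ) =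
              ((symbolCount s k l : ℝ) + 1 + z l) *
                ((symbolCount s k l + 1).ascFactorial (z l) : ℝ) := by
            exact_mod_cast Nat.succ_ascFactorial (symbolCount s k l + 1) (z l)
          have h2 : ((z l).factorial : ℝ) ≠ 0 := by exact_mod_cast Nat.factorial_ne_zero _
          have h3 : (symbolCount s k l : ℝ) + 1 ≠ 0 := by positivity
          field_simp
          linarith
        · simp
      rw [Finset.prod_congr rfl fun l _ => this l, Finset.prod_mul_distrib, Finset.prod_ite_eq]
      simp
    have hden : ((N : ℝ) + k) * ((N + (k + 1)).ascFactorial R : ℝ) =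
        ((N : ℝ) + k + R) * ((N + k).ascFactorial R : ℝ) := by
      exact_mod_cast Nat.succ_ascFactorial (N + k) R
    rw [Finset.prod_range_succ, ih, hprod, likelihoodFactor, symbolCount_succ, if_pos rfl]
    have hNk : (0 : ℝ) < (N : ℝ) + k := by positivity
    have h1 := hasc (N + (k + 1)) R (by omega)
    have h2 := hasc (N + k) R (by omega)
    push_cast
    have e1 : (N : ℝ) + (k + 1) - 1 = N + k := by ring
    have e2 : (R : ℝ) + (k + 1) + N - 1 = N + k + R := by ring
    rw [e1, e2]
    have h3 : (N : ℝ) + k + R ≠ 0 := by positivity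
    have h4 : ((N : ℝ) + k) / ((N : ℝ) + k + R) =
        ((N + k).ascFactorial R : ℝ) / ((N + (k + 1)).ascFactorial R : ℝ) := by
      rw [div_eq_div_iff h3 h1, hden]; ring
    have h5 : (symbolCount s k (s (k + 1)) : ℝ) + 1 ≠ 0 := by positivity
    rw [mul_comm (_ + _) ((N : ℝ) + k), mul_div_mul_comm, h4]
    field_simp
    ring

theorem tendsto_ascFactorial_div_pow {a : ℕ → ℕ} {p : ℝ}
    (ha : Tendsto (fun k : ℕ => (a k : ℝ) / k) atTop (𝓝 p)) (z : ℕ) :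
    Tendsto (fun k : ℕ => ((a k).ascFactorial z : ℝ) / (k : ℝ) ^ z) atTop (𝓝 (p ^ z)) := by
  induction z with
  | zero => simp
  | succ z ih =>
    have h1 : Tendsto (fun k : ℕ => (a k : ℝ) / k + (z : ℝ) / k) atTop (𝓝 (p + 0)) :=
      ha.add (tendsto_const_div_atTop_nhds_zero_nat _)
    rw [add_zero] at h1
    rw [pow_succ']
    refine (h1.mul ih).congr fun k => ?_
    rw [Nat.ascFactorial_succ, pow_succ', ← add_div, div_mul_div_comm]
    push_cast
    rfl

theorem tendsto_natCast_add_div (c : ℕ) :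
    Tendsto (fun k : ℕ => ((c + k : ℕ) : ℝ) / k) atTop (𝓝 1) := by
  have h := (tendsto_const_div_atTop_nhds_zero_nat (c : ℝ)).add_const 1
  rw [zero_add] at h
  refine h.congr' ?_
  filter_upwards [eventually_gt_atTop 0] with k hk
  have : (k : ℝ) ≠ 0 := by positivity
  push_cast
  field_simp

theorem tendsto_prod_likelihoodFactor {z : Fin N → ℕ} {R : ℕ} {s : ℕ → Fin N} {p : Fin N → ℝ}
    (hz : ∑ l, z l = R)
    (hs : ∀ l, Tendsto (fun k : ℕ => (symbolCount s k l : ℝ) / k) atTop (𝓝 (p l))) :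
    Tendsto (fun k => ∏ t ∈ Finset.range k,
        likelihoodFactor z R (t + 1) (symbolCount s (t + 1)) (s (t + 1))) atTop
      (𝓝 ((∏ l, p l ^ z l / (z l).factorial) * N.ascFactorial R)) := by
  have h1 : ∀ l, Tendsto (fun k : ℕ => ((symbolCount s k l + 1).ascFactorial (z l) : ℝ) /
      (k : ℝ) ^ z l / (z l).factorial) atTop (𝓝 (p l ^ z l / (z l).factorial)) := by
    intro l
    refine (tendsto_ascFactorial_div_pow ?_ (z l)).div_const _
    have := (hs l).add (tendsto_const_div_atTop_nhds_zero_nat 1)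
    rw [add_zero] at this
    refine this.congr fun k => ?_
    push_cast
    rw [add_div]
  have h2 := tendsto_ascFactorial_div_pow (tendsto_natCast_add_div N) R
  rw [one_pow] at h2
  have h3 := (tendsto_finsetProd Finset.univ fun l _ => h1 l).mul
    ((h2.inv₀ one_ne_zero).const_mul (N.ascFactorial R : ℝ))
  rw [inv_one, mul_one] at h3
  refine h3.congr' ?_
  filter_upwards [eventually_gt_atTop 0] with k hk
  have hk' : (k : ℝ) ≠ 0 := by positivity
  rw [prod_likelihoodFactor]
  simp only [div_right_comm _ ((k : ℝ) ^ _)]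
  -- As `∑ l, z l = R`, the powers of `k` normalising numerator and denominator cancel.
  rw [Finset.prod_div_distrib (g := fun l => (k : ℝ) ^ z l), Finset.prod_pow_eq_pow_sum, hz]
  field_simp

/-- The factor is `(1 + z a / n a)` times a ratio tending to `1`. The current symbol `a` changes
with time, so `z a / n a` is bounded by the sum over all symbols with `p l > 0`, whose counts all
diverge. -/
theorem tendsto_likelihoodFactor (z : Fin N → ℕ) (R : ℕ) {s : ℕ → Fin N} {p : Fin N → ℝ}
    (hp : ∀ k, 0 < p (s (k + 1)))
    (hs : ∀ l, Tendsto (fun k : ℕ => (symbolCount s k l : ℝ) / k) atTop (𝓝 (p l))) :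
    Tendsto (fun k => likelihoodFactor z R (k + 1) (symbolCount s (k + 1)) (s (k + 1))) atTop
      (𝓝 1) := by
  classical
  have hN : 0 < N := Fin.pos (s 0)
  have hcount : ∀ l, 0 < p l →
      Tendsto (fun k : ℕ => (z l : ℝ) / symbolCount s (k + 1) l) atTop (𝓝 0) := by
    intro l hl
    have h1 := (hs l).pos_mul_atTop hl tendsto_natCast_atTop_atTop
    have h2 : Tendsto (fun k : ℕ => (symbolCount s k l : ℝ)) atTop atTop := by
      refine h1.congr' ?_
      filter_upwards [eventually_gt_atTop 0] with k hk
      exact div_mul_cancel₀ _ (by positivity)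
    exact (h2.comp (tendsto_add_atTop_nat 1)).const_div_atTop _
  have hratio : Tendsto (fun k : ℕ =>
      (z (s (k + 1)) : ℝ) / symbolCount s (k + 1) (s (k + 1))) atTop (𝓝 0) := by
    have hbound : Tendsto (fun k : ℕ => ∑ l ∈ Finset.univ.filter (fun l => 0 < p l),
        (z l : ℝ) / symbolCount s (k + 1) l) atTop (𝓝 0) := by
      simpa using tendsto_finsetSum (Finset.univ.filter fun l => 0 < p l)
        fun l hl => hcount l (Finset.mem_filter.1 hl).2
    refine squeeze_zero (fun k => by positivity) (fun k => ?_) hbound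
    exact Finset.single_le_sum (f := fun l => (z l : ℝ) / symbolCount s (k + 1) l)
      (fun l _ => by positivity) (Finset.mem_filter.2 ⟨Finset.mem_univ _, hp k⟩)
  have hfrac : Tendsto (fun k : ℕ => ((N + k : ℕ) : ℝ) / k / (((R + N + k : ℕ) : ℝ) / k)) atTop
      (𝓝 (1 / 1)) :=
    (tendsto_natCast_add_div N).div (tendsto_natCast_add_div (R + N)) one_ne_zero
  have h := (hratio.const_add 1).mul hfrac
  rw [add_zero, one_div_one, one_mul] at h
  refine h.congr' ?_
  filter_upwards [eventually_gt_atTop 0] with k hk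
  have hk' : (k : ℝ) ≠ 0 := by positivity
  have hn : (symbolCount s (k + 1) (s (k + 1)) : ℝ) ≠ 0 := by
    exact_mod_cast (symbolCount_self_pos s k).ne'
  have hR : (R : ℝ) + N + k ≠ 0 := by positivity
  unfold likelihoodFactor
  push_cast
  have e1 : (N : ℝ) + (k + 1) - 1 = N + k := by ring
  have e2 : (R : ℝ) + (k + 1) + N - 1 = R + N + k := by ring
  rw [e1, e2]
  field_simp
  ring

/-- The Gamma functions at `z l + 1` are factorials, and `Γ(R + N) / Γ(N)` is the rising factorial.
-/
theorem dirichlet_div_dirichlet_one {z : Fin N → ℕ} {R : ℕ} (p : Fin N → ℝ) (hN : 0 < N)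
    (hz : ∑ l, z l = R) :
    dirichlet p (fun l => (z l : ℝ) + 1) / dirichlet p (fun _ => 1) =
      (∏ l, p l ^ z l / (z l).factorial) * N.ascFactorial R := by
  have hN' : (0 : ℝ) < N := by exact_mod_cast hN
  have hΓ : ∀ R : ℕ, Real.Gamma ((R : ℝ) + N) = N.ascFactorial R * Real.Gamma N := by
    intro R
    induction R with
    | zero => simp
    | succ R ih =>
      have : ((R + 1 : ℕ) : ℝ) + N = ((R : ℝ) + N) + 1 := by push_cast; ring
      rw [this, Real.Gamma_add_one (by positivity), ih, Nat.ascFactorial_succ]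
      push_cast
      ring
  have hz' : ∑ l, ((z l : ℝ) + 1) = (R : ℝ) + N := by
    rw [Finset.sum_add_distrib, ← hz]
    simp
  have hΓN : Real.Gamma N ≠ 0 := (Real.Gamma_pos_of_pos hN').ne'
  have hfac : (∏ l, ((z l).factorial : ℝ)) ≠ 0 :=
    Finset.prod_ne_zero_iff.2 fun l _ => by exact_mod_cast Nat.factorial_ne_zero _
  simp only [dirichlet, multiBeta, hz', hΓ, Real.Gamma_nat_eq_factorial, add_sub_cancel_right,
    Real.rpow_natCast, sub_self, Real.rpow_zero, Finset.prod_const_one, Real.Gamma_one,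
    Finset.sum_const, Finset.card_univ, Fintype.card_fin, nsmul_eq_mul, mul_one,
    Finset.prod_div_distrib]
  field_simp

end Likelihood

/-! ### Beliefs along a fixed realisation -/

theorem extLog_mul {x : ℝ} (hx : 0 ≤ x) (y : ℝ) : extLog (x * y) = extLog x + extLog y := by
  rw [extLog, ENNReal.ofReal_mul hx, ENNReal.log_mul_add, extLog, extLog]

theorem extLog_prod {ι : Type*} (s : Finset ι) {f : ι → ℝ} (hf : ∀ i, 0 ≤ f i) :
    extLog (∏ i ∈ s, f i) = ∑ i ∈ s, extLog (f i) := by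
  classical
  induction s using Finset.induction_on with
  | empty => simp [extLog]
  | insert a s ha ih => rw [Finset.prod_insert ha, Finset.sum_insert ha, extLog_mul (hf a), ih]

theorem extLog_rpow {x y : ℝ} (hx : 0 ≤ x) (hy : 0 ≤ y) : extLog (x ^ y) = y * extLog x := by
  rw [extLog, ← ENNReal.ofReal_rpow_of_nonneg hx hy, ENNReal.log_rpow, extLog]

theorem extLog_of_pos {x : ℝ} (hx : 0 < x) : extLog x = Real.log x :=
  ENNReal.log_ofReal_of_pos hx

theorem continuous_extLog : Continuous extLog :=
  ENNReal.continuous_log.comp ENNReal.continuous_ofReal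

section Belief

variable {m N : ℕ} (G : ℕ → Digraph (Fin m)) (z : Fin m → Fin N → ℕ) (R : Fin m → ℕ)
  (s : Fin m → ℕ → Fin N)

theorem belief_pos (k : ℕ) (i : Fin m) : 0 < belief G z R s k i := by
  induction k generalizing i with
  | zero => exact one_pos
  | succ k ih =>
    rw [belief]
    exact Real.rpow_pos_of_pos (mul_pos (Finset.prod_pos fun j _ => Real.rpow_pos_of_pos (ih j) _)
      (likelihoodFactor_pos (z i) (R i) (s i) k)) _

theorem pushSum_mul_log_belief_succ (k : ℕ) (i : Fin m) :
    pushSum G (k + 1) i * Real.log (belief G z R s (k + 1) i) =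
      ∑ j ∈ inNeighbors G k i,
        pushSum G k j / ((outDegree G k j : ℝ) + 1) * Real.log (belief G z R s k j) +
      Real.log (likelihoodFactor (z i) (R i) (k + 1) (symbolCount (s i) (k + 1)) (s i (k + 1))) := by
  have hpos := fun j => belief_pos G z R s k j
  have hprod : 0 < ∏ j ∈ inNeighbors G k i,
      belief G z R s k j ^ (pushSum G k j / ((outDegree G k j : ℝ) + 1)) :=
    Finset.prod_pos fun j _ => Real.rpow_pos_of_pos (hpos j) _
  have hℓ := likelihoodFactor_pos (z i) (R i) (s i) k
  rw [belief, Real.log_rpow (mul_pos hprod hℓ), ← mul_assoc,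
    mul_one_div_cancel (pushSum_pos G (k + 1) i).ne', one_mul, Real.log_mul hprod.ne' hℓ.ne',
    Real.log_prod fun j _ => (Real.rpow_pos_of_pos (hpos j) _).ne']
  simp only [Real.log_rpow (hpos _)]

variable {G z R s}

theorem tendsto_log_belief {B : ℕ} (hG : BStronglyConnected G B) {p : Fin m → Fin N → ℝ}
    (hp : ∀ j l, 0 ≤ p j l) (hz : ∀ j, ∑ l, z j l = R j)
    (hps : ∀ j k, 0 < p j (s j (k + 1)))
    (hs : ∀ j l, Tendsto (fun k : ℕ => (symbolCount (s j) k l : ℝ) / k) atTop (𝓝 (p j l)))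
    (i : Fin m) :
    Tendsto (fun k : ℕ => ((Real.log (belief G z R s k i) : ℝ) : EReal)) atTop
      (𝓝 (((1 / (m : ℝ) : ℝ) : EReal) * ∑ j : Fin m,
        extLog (dirichlet (p j) (fun l => (z j l : ℝ) + 1) / dirichlet (p j) (fun _ => 1)))) := by
  have hN : 0 < N := Fin.pos (s i 0)
  have hm : (0 : ℝ) ≤ 1 / (m : ℝ) := by positivity
  set ℓ : ℕ → Fin m → ℝ := fun k j =>
    likelihoodFactor (z j) (R j) (k + 1) (symbolCount (s j) (k + 1)) (s j (k + 1)) with hℓ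
  have ℓ_pos : ∀ k j, 0 < ℓ k j := fun k j => likelihoodFactor_pos (z j) (R j) (s j) k
  set q : Fin m → ℝ := fun j =>
    (∏ l, p j l ^ z j l / (z j l).factorial) * N.ascFactorial (R j) with hq
  have q_nonneg : ∀ j, 0 ≤ q j := fun j =>
    mul_nonneg (Finset.prod_nonneg fun l _ => div_nonneg (pow_nonneg (hp j l) _)
      (Nat.cast_nonneg _)) (Nat.cast_nonneg _)
  -- The belief is the exponential of the consensus error times the geometric mean over agents of
  -- the accumulated products. This form stays in the reals even when some `q j = 0`.
  have hlim : Tendsto (fun k => Real.exp (Real.log (belief G z R s k i) -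
        1 / (m : ℝ) * ∑ j, ∑ t ∈ Finset.range k, Real.log (ℓ t j)) *
      (∏ j, ∏ t ∈ Finset.range k, ℓ t j) ^ (1 / (m : ℝ))) atTop
      (𝓝 (Real.exp 0 * (∏ j, q j) ^ (1 / (m : ℝ)))) := by
    refine Tendsto.mul ((Real.continuous_exp.tendsto 0).comp ?_) ?_
    · refine tendsto_sub_average hG (r := fun k j => Real.log (belief G z R s k j))
        (u := fun k j => Real.log (ℓ k j)) (fun j => by simp [belief])
        (pushSum_mul_log_belief_succ G z R s) (fun j => ?_) i
      have := (tendsto_likelihoodFactor (z j) (R j) (hps j) (hs j)).log one_ne_zero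
      rwa [Real.log_one] at this
    · exact (tendsto_finsetProd Finset.univ fun j _ =>
        tendsto_prod_likelihoodFactor (hz j) (hs j)).rpow_const (Or.inr hm)
  have hbelief : Tendsto (fun k => belief G z R s k i) atTop
      (𝓝 ((∏ j, q j) ^ (1 / (m : ℝ)))) := by
    rw [Real.exp_zero, one_mul] at hlim
    refine hlim.congr fun k => ?_
    have hP : 0 < ∏ j, ∏ t ∈ Finset.range k, ℓ t j :=
      Finset.prod_pos fun j _ => Finset.prod_pos fun t _ => ℓ_pos t j
    have hlog : ∑ j, ∑ t ∈ Finset.range k, Real.log (ℓ t j) =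
        Real.log (∏ j, ∏ t ∈ Finset.range k, ℓ t j) := by
      rw [Real.log_prod fun j _ => (Finset.prod_pos fun t _ => ℓ_pos t j).ne']
      exact Finset.sum_congr rfl fun j _ => (Real.log_prod fun t _ => (ℓ_pos t j).ne').symm
    rw [hlog, Real.rpow_def_of_pos hP, ← Real.exp_add, mul_comm (Real.log _), sub_add_cancel,
      Real.exp_log (belief_pos G z R s k i)]
  have h := (continuous_extLog.tendsto _).comp hbelief
  rw [extLog_rpow (Finset.prod_nonneg fun j _ => q_nonneg j) hm,
    extLog_prod _ q_nonneg] at h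
  simp only [dirichlet_div_dirichlet_one _ hN (hz _)]
  exact h.congr fun k => extLog_of_pos (belief_pos G z R s k i)

end Belief

/-! ### Almost sure properties of the data -/

section Data

variable {Ω : Type*} [MeasurableSpace Ω] {P : Measure Ω} [IsProbabilityMeasure P] {N : ℕ}

/-- There are only countably many count vectors, and each one with the wrong total has probability
zero. -/
theorem ae_sum_eq_of_multinomial {p : Fin N → ℝ} {n : ℕ} {Z : Ω → Fin N → ℕ}
    (hZ : ∀ x, P.real {ω | Z ω = x} = multinomialPMF p n x) : ∀ᵐ ω ∂P, ∑ l, Z ω l = n := by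
  have h : ∀ᵐ ω ∂P, ∀ x : Fin N → ℕ, ∑ l, x l ≠ n → Z ω ≠ x := by
    refine ae_all_iff.2 fun x => ?_
    by_cases hx : ∑ l, x l = n
    · simp [hx]
    · have h0 := hZ x
      rw [multinomialPMF, if_neg hx, measureReal_eq_zero_iff] at h0
      rw [ae_iff]
      simpa [hx] using h0
  filter_upwards [h] with ω hω
  by_contra hne
  exact hω _ hne rfl

variable {S : ℕ → Ω → Fin N} {p : Fin N → ℝ}

theorem ae_forall_pos_of_law (hp : ∀ l, 0 ≤ p l)
    (hlaw : ∀ k l, 1 ≤ k → P.real {ω | S k ω = l} = p l) :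
    ∀ᵐ ω ∂P, ∀ k, 0 < p (S (k + 1) ω) := by
  refine ae_all_iff.2 fun k => ?_
  have h : ∀ᵐ ω ∂P, ∀ l, p l = 0 → S (k + 1) ω ≠ l := by
    refine ae_all_iff.2 fun l => ?_
    by_cases hl : p l = 0
    · have h0 := hlaw (k + 1) l (by omega)
      rw [hl, measureReal_eq_zero_iff] at h0
      rw [ae_iff]
      simpa [hl] using h0
    · simp [hl]
  filter_upwards [h] with ω hω
  exact (hp _).lt_of_ne fun h0 => hω _ h0.symm rfl

/-- The strong law of large numbers for symbol frequencies. -/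
theorem ae_tendsto_symbolCount_div (hmeas : ∀ k, 1 ≤ k → Measurable (S k))
    (hindep : iIndepFun (fun k : ℕ => S (k + 1)) P)
    (hlaw : ∀ k l, 1 ≤ k → P.real {ω | S k ω = l} = p l) :
    ∀ᵐ ω ∂P, ∀ l,
      Tendsto (fun k : ℕ => (symbolCount (fun t => S t ω) k l : ℝ) / k) atTop (𝓝 (p l)) := by
  classical
  refine ae_all_iff.2 fun l => ?_
  have hf : Measurable fun a : Fin N => if a = l then (1 : ℝ) else 0 := measurable_of_finite _
  have hSm : ∀ k, Measurable (S (k + 1)) := fun k => hmeas _ (by omega)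
  -- Symbols start at time `1`, so with this shift the sum over `range k` counts the times `1, …,
  -- k`.
  set X : ℕ → Ω → ℝ := fun k ω => if S (k + 1) ω = l then 1 else 0 with hX
  have hident : ∀ k, IdentDistrib (X k) (X 0) P P := by
    intro k
    refine IdentDistrib.comp (f := S (k + 1)) (g := S (0 + 1))
      ⟨(hSm k).aemeasurable, (hSm 0).aemeasurable, ?_⟩ hf
    refine Measure.ext_of_singleton fun a => ?_
    rw [Measure.map_apply (hSm k) (measurableSet_singleton a),
      Measure.map_apply (hSm 0) (measurableSet_singleton a)]
    have h := (hlaw (k + 1) a (by omega)).trans (hlaw (0 + 1) a (by omega)).symm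
    exact (measureReal_eq_measureReal_iff).1 h
  have hXind : X 0 = Set.indicator {ω | S 1 ω = l} 1 := by
    ext ω
    simp [hX, Set.indicator_apply]
  have hset : MeasurableSet {ω | S 1 ω = l} := hSm 0 (measurableSet_singleton l)
  have hint : Integrable (X 0) P := by
    rw [hXind]
    exact (integrable_const (1 : ℝ)).indicator hset
  have hmean : P[X 0] = p l := by
    rw [hXind, integral_indicator_one hset]
    exact hlaw 1 l le_rfl
  have hslln := strong_law_ae_real X hint
    (fun a b hab => (hindep.indepFun hab).comp hf hf) hident
  rw [hmean] at hslln
  filter_upwards [hslln] with ω hω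
  refine hω.congr fun k => ?_
  congr 1
  induction k with
  | zero => simp [symbolCount]
  | succ k ih =>
    rw [Finset.sum_range_succ, ih, symbolCount_succ]
    push_cast
    rfl

end Data

end SocialLearning

/-! ### Assembly: the pathwise limit on an event of full probability -/

theorem theorem1 {Ω : Type*} [MeasurableSpace Ω] (P : Measure Ω) [IsProbabilityMeasure P]
    {m N : ℕ} {Θ : Type*} [Finite Θ] (θstar : Θ)
    (G : ℕ → Digraph (Fin m)) (hG : ∃ B : ℕ, SocialLearning.BStronglyConnected G B)
    (p : Fin m → Θ → Fin N → ℝ) (hp : ∀ i θ, p i θ ∈ stdSimplex ℝ (Fin N))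
    (S : Fin m → ℕ → Ω → Fin N)
    (hSmeas : ∀ i k, 1 ≤ k → Measurable (S i k))
    (hSindep : ∀ i, iIndepFun (fun k : ℕ => S i (k + 1)) P)
    (hSlaw : ∀ i k l, 1 ≤ k → P.real {ω | S i k ω = l} = p i θstar l)
    (R : Fin m → Θ → ℕ) (Z : Fin m → Θ → Ω → Fin N → ℕ)
    (hZmeas : ∀ i θ, Measurable (Z i θ))
    (hZlaw : ∀ i θ x,
      P.real {ω | Z i θ ω = x} = SocialLearning.multinomialPMF (p i θ) (R i θ) x) :
    ∀ᵐ ω ∂P, ∀ (i : Fin m) (θ : Θ),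
      (∀ k : ℕ, 0 < SocialLearning.belief G (fun j => Z j θ ω) (fun j => R j θ)
        (fun j t => S j t ω) k i) ∧
      Tendsto
        (fun k : ℕ => ((Real.log (SocialLearning.belief G (fun j => Z j θ ω) (fun j => R j θ)
          (fun j t => S j t ω) k i) : ℝ) : EReal))
        atTop
        (𝓝 (((1 / (m : ℝ) : ℝ) : EReal) * ∑ j : Fin m,
          SocialLearning.extLog
            (SocialLearning.dirichlet (p j θstar) (fun l => (Z j θ ω l : ℝ) + 1) /
              SocialLearning.dirichlet (p j θstar) (fun _ => 1)))) := by
  obtain ⟨B, hG⟩ := hG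
  have hZ : ∀ᵐ ω ∂P, ∀ j θ, ∑ l, Z j θ ω l = R j θ :=
    ae_all_iff.2 fun j => ae_all_iff.2 fun θ =>
      SocialLearning.ae_sum_eq_of_multinomial (hZlaw j θ)
  have hpos : ∀ᵐ ω ∂P, ∀ j k, 0 < p j θstar (S j (k + 1) ω) :=
    ae_all_iff.2 fun j => SocialLearning.ae_forall_pos_of_law (hp j θstar).1 (hSlaw j)
  have hfreq := ae_all_iff.2 fun j =>
    SocialLearning.ae_tendsto_symbolCount_div (hSmeas j) (hSindep j) (hSlaw j)
  filter_upwards [hZ, hpos, hfreq] with ω hZω hposω hfreqω i θ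
  exact ⟨fun k => SocialLearning.belief_pos G _ _ _ k i,
    SocialLearning.tendsto_log_belief hG (fun j => (hp j θstar).1) (fun j => hZω j θ) hposω
      hfreqω i⟩
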